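/- Let $\alpha>0$ be an ordinal, let $V={}^{\alpha}\mathbb{Q}^{(\mathbf 0)}$ be the set of sequences $s\in{}^{\alpha}\mathbb{Q}$ with $s_i\neq 0$ for only finitely many $i<\alpha$, and let $\mathfrak C$ be the full quasi-polyadic equality set algebra with unit $V$: its elements are all subsets of $V$, its Boolean operations are the set-theoretic ones (complement relative to $V$), and its other operations are, for $i,j<\alpha$ and $X\subseteq V$, the cylindrifications $\mathsf c_iX=\{s\in V:\exists t\in X,\ t_k=s_k\text{ for all }k\neq i\}$, the diagonal elements $\mathsf d_{ij}=\{s\in V:s_i=s_j\}$ and the substitutions $\mathsf s_{[i,j]}X=\{s\in V:s\circ[i,j]\in X\}$, where $[i,j]$ is the transposition interchanging $i$ and $j$. For $k\in\mathbb N$ let $a_k=\{s\in V:\sum_{i<\alpha}s_i=k\}$, and for $n\in\mathbb N$ let $\mathfrak A_n$ be the subalgebra of $\mathfrak C$ generated by $\{a_k:k<2^n\}$. Then for every $n\in\mathbb N$ the algebra $\mathfrak A_n$ is simple (it has exactly two congruences), no set of at most $n$ of its elements generates it, and some set of exactly $n+1$ of its elements generates it. Consequently, for every ordinal $\alpha>0$,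 finite or infinite, there is a simple, finitely generated, representable quasi-polyadic equality algebra of dimension $\alpha$ that is not generated by any single element. Here an algebra is representable if it is isomorphic to a subalgebra of a direct product of full set algebras, that is, of algebras of all subsets of ${}^{\alpha}U$ for sets $U$, with the operations defined as above with ${}^{\alpha}U$ in place of $V$. -/

import Mathlib

universe u v w

namespace QEA

/-- The extra-Boolean operations of a quasi-polyadic equality algebra of dimension `ι`:
cylindrifications `c_i`, diagonal elements `d_ij` and the substitutions `s_[i,j]` along
transpositions. -/
class Ops (ι : Type u) (A : Type v) where
  cyl : ι → A → A
  diag : ι → ι → A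
  subst : ι → ι → A → A

section Set

variable {ι : Type u} {U : Type v}

open Classical in
/-- The set algebra of all subsets of a unit `W ⊆ ^ιU`. Its Boolean operations are those of
the Boolean set algebra `℘(W)`, and the other operations are the relativizations to `W` of
`c_i X = {s | ∃ t ∈ X, t and s agree off i}`, `d_ij = {s | s_i = s_j}` and
`s_[i,j] X = {s | s ∘ [i,j] ∈ X}`. -/
instance setOps (W : Set (ι → U)) : Ops ι (Set W) where
  cyl i X := {s | ∃ t ∈ X, ∀ j, j ≠ i → t.1 j = s.1 j}
  diag i j := {s | s.1 i = s.1 j}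
  subst i j X := {s | ∃ t ∈ X, t.1 = s.1 ∘ Equiv.swap i j}

/-- The weak space `^ιU^(p)`: the sequences that differ from `p` in only finitely many places. -/
def weakSpace (p : ι → U) : Set (ι → U) := {s | {i | s i ≠ p i}.Finite}

end Set

/-- Direct products. -/
instance piOps {ι : Type u} {J : Type v} (A : J → Type w) [∀ j, Ops ι (A j)] :
    Ops ι (∀ j, A j) where
  cyl i x := fun j => Ops.cyl i (x j)
  diag i k := fun _ => Ops.diag i k
  subst i k x := fun j => Ops.subst i k (x j)

section Algebra

variable (ι : Type u) {A : Type v} [BooleanAlgebra A] [Ops ι A]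

/-- Membership in the subalgebra generated by `X`. -/
inductive InSg (X : Set A) : A → Prop
  | basic {x : A} : x ∈ X → InSg X x
  | bot : InSg X ⊥
  | sup {x y : A} : InSg X x → InSg X y → InSg X (x ⊔ y)
  | compl {x : A} : InSg X x → InSg X xᶜ
  | cyl (i : ι) {x : A} : InSg X x → InSg X (Ops.cyl i x)
  | diag (i j : ι) : InSg X (Ops.diag i j)
  | subst (i j : ι) {x : A} : InSg X x → InSg X (Ops.subst i j x)

variable (A) in
/-- Subalgebras. -/
structure Subalgebra extends BooleanSubalgebra A where
  cyl_mem' : ∀ (i : ι) {x : A}, x ∈ carrier → Ops.cyl i x ∈ carrier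
  diag_mem' : ∀ i j : ι, (Ops.diag i j : A) ∈ carrier
  subst_mem' : ∀ (i j : ι) {x : A}, x ∈ carrier → Ops.subst i j x ∈ carrier

/-- The subalgebra generated by `X`. -/
def Sg (X : Set A) : Subalgebra ι A where
  carrier := {x | InSg ι X x}
  supClosed' := fun _ hx _ hy => InSg.sup hx hy
  infClosed' := fun x hx y hy => by
    have h : InSg ι X (xᶜ ⊔ yᶜ)ᶜ := (InSg.sup hx.compl hy.compl).compl
    simpa using h
  compl_mem' := fun hx => InSg.compl hx
  bot_mem' := InSg.bot
  cyl_mem' := fun i _ hx => InSg.cyl i hx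
  diag_mem' := fun i j => InSg.diag i j
  subst_mem' := fun i j _ hx => InSg.subst i j hx

/-- The underlying type of a subalgebra. -/
abbrev Subalgebra.Carrier {ι : Type u} {A : Type v} [BooleanAlgebra A] [Ops ι A]
    (S : Subalgebra ι A) : Type v := S.toBooleanSubalgebra

/-- A subalgebra is an algebra under the restricted operations
(the Boolean part is Mathlib's structure on a Boolean subalgebra). -/
instance subalgebraOps {ι : Type u} {A : Type v} [BooleanAlgebra A] [Ops ι A]
    (S : Subalgebra ι A) : Ops ι S.Carrier where
  cyl i x := ⟨Ops.cyl i x.1, S.cyl_mem' i x.2⟩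
  diag i j := ⟨Ops.diag i j, S.diag_mem' i j⟩
  subst i j x := ⟨Ops.subst i j x.1, S.subst_mem' i j x.2⟩

/-- `X` generates the whole algebra. -/
def Generates (X : Set A) : Prop := ∀ a : A, InSg ι X a

/-- Congruences. -/
structure IsCongruence (r : Setoid A) : Prop where
  sup : ∀ {x x' y y' : A}, r x x' → r y y' → r (x ⊔ y) (x' ⊔ y')
  inf : ∀ {x x' y y' : A}, r x x' → r y y' → r (x ⊓ y) (x' ⊓ y')
  compl : ∀ {x x' : A}, r x x' → r xᶜ x'ᶜ
  cyl : ∀ (i : ι) {x x' : A}, r x x' → r (Ops.cyl i x) (Ops.cyl i x')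
  subst : ∀ (i j : ι) {x x' : A}, r x x' → r (Ops.subst i j x) (Ops.subst i j x')

variable (A) in
/-- An algebra is simple if it has exactly two congruences, the identity `⊥` and the
total relation `⊤`. -/
def IsSimple : Prop :=
  Nontrivial A ∧ ∀ r : Setoid A, IsCongruence ι r → r = ⊥ ∨ r = ⊤

/-- Homomorphisms. -/
structure IsHom {B : Type w} [BooleanAlgebra B] [Ops ι B] (f : A → B) : Prop where
  bot : f ⊥ = ⊥
  top : f ⊤ = ⊤
  sup : ∀ x y, f (x ⊔ y) = f x ⊔ f y
  inf : ∀ x y, f (x ⊓ y) = f x ⊓ f y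
  compl : ∀ x, f xᶜ = (f x)ᶜ
  cyl : ∀ (i : ι) (x : A), f (Ops.cyl i x) = Ops.cyl i (f x)
  diag : ∀ i j : ι, f (Ops.diag i j) = Ops.diag i j
  subst : ∀ (i j : ι) (x : A), f (Ops.subst i j x) = Ops.subst i j (f x)

end Algebra

/-- Representable quasi-polyadic equality algebras of dimension `ι`: the algebras that embed
into a product of full set algebras with units `^ιU`. -/
def IsRepresentable (ι A : Type u) [BooleanAlgebra A] [Ops ι A] : Prop :=
  ∃ (J : Type u) (U : J → Type u)
    (f : A → ∀ j, Set (Set.univ : Set (ι → U j))),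
    IsHom ι f ∧ Function.Injective f

section Rational

variable (ι : Type u)

/-- The weak space `V = ^ιℚ^(0)` of finitely supported sequences of rationals. -/
abbrev V : Set (ι → ℚ) := weakSpace (fun _ => 0)

/-- The full set algebra on `V`. -/
abbrev C : Type u := Set (V ι)

variable {ι} in
/-- The hyperplane `[t, r] = {s ∈ V | t = ∑ r_i s_i}`. The sum has finitely many nonzero
terms, since `s` is finitely supported. -/
def hyperplane (t : ℚ) (r : ι → ℚ) : C ι := {s | t = ∑ᶠ i, r i * s.1 i}

/-- `a_k = [k, 1]`, where `1` is the constant sequence. -/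
def a (k : ℕ) : C ι := hyperplane (k : ℚ) (fun _ => 1)

/-- `A_n`, the subalgebra of the full set algebra on `V` generated by the `a_k`, `k < 2 ^ n`. -/
def subalg (n : ℕ) : Subalgebra ι (C ι) := Sg ι {x | ∃ k < 2 ^ n, x = a ι k}

/-- The algebra `A_n`. -/
abbrev Alg (n : ℕ) : Type u := (subalg ι n).Carrier

end Rational

end QEA

/-!
The elements of `A_n` are finite Boolean combinations of affine hyperplanes: cylindrification
eliminates a coordinate from a system of linear equations and inequations, because a line over an
infinite field contains points off any finite number of hyperplanes.

*Simplicity.* If `X` is determined by finitely many hyperplanes, finitely many coordinates are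
enough to realize all tuples of values of the linear parts of their equations. So cylindrifying a
nonempty `X` along these coordinates gives the unit, and a congruence that relates a nonempty set to
the empty one is total.

*At least `n + 1` generators.* A determined set contains almost all or almost no points of the
hyperplane `level c`, where finitely many hyperplanes not parallel to `level c` are negligible.
This truth value commutes with the Boolean operations and with the substitutions. It does not
depend on `c` for diagonals and for cylindrifications, because these are determined by hyperplanes
of which none is parallel to `level c`. A set of at most `n` elements realizes at most `2 ^ n`
patterns of truth values, so it cannot tell apart the `2 ^ n` levels among the generators and one
further level from each other, whereas the elements of `A_n` can.

*At most `n + 1` generators.* Code the `2 ^ n` pairwise disjoint generators by nonempty sets of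
`n + 1` digits. The joins of the generators sharing a digit generate all of them.

*Representability.* Take an ultrapower of the base along an ultrafilter on the finite sets `Δ` of
indices, and approximate a sequence in the ultrapower by the points of the weak space which agree
with a representative on `Δ` and with the base point elsewhere. Choosing constant representatives
for constants makes the approximations of a point of the weak space eventually equal to it, whence
the representation is injective.
-/

namespace QEA

open Function Filter

section BooleanAlgebra

variable {B κ : Type*} [BooleanAlgebra B]

/-- The `j`-th digit of a family `f` indexed by coded elements: the join of the members of `f`
whose code contains `j`. The members of a disjoint family are recovered from its digits. -/
def digit [Fintype κ] {m : ℕ} (f : κ → B) (code : κ → Finset (Fin m)) (j : Fin m) : B :=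
  (Finset.univ.filter fun k => j ∈ code k).sup f

theorem disjoint_digit [Fintype κ] {m : ℕ} {f : κ → B} (hf : Pairwise (Disjoint on f))
    {code : κ → Finset (Fin m)} {j : Fin m} {k : κ} (hj : j ∉ code k) :
    Disjoint (f k) (digit f code j) := by
  refine Finset.disjoint_sup_right.2 fun l hl => hf ?_
  rintro rfl
  exact hj (Finset.mem_filter.1 hl).2

theorem le_digit [Fintype κ] {m : ℕ} {f : κ → B} {code : κ → Finset (Fin m)} {j : Fin m} {k : κ}
    (hj : j ∈ code k) : f k ≤ digit f code j :=
  Finset.le_sup (f := f) (Finset.mem_filter.2 ⟨Finset.mem_univ k, hj⟩)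

theorem eq_inf_digit [Fintype κ] {m : ℕ} {f : κ → B} (hf : Pairwise (Disjoint on f))
    {code : κ → Finset (Fin m)} (hcode : Injective code) {k : κ} (hk : (code k).Nonempty) :
    f k = Finset.univ.inf fun j =>
      if j ∈ code k then digit f code j else (digit f code j)ᶜ := by
  set x := Finset.univ.inf fun j => if j ∈ code k then digit f code j else (digit f code j)ᶜ
    with hx
  have x_le_digit {j} (hj : j ∈ code k) : x ≤ digit f code j :=
    (Finset.inf_le (Finset.mem_univ j)).trans_eq (if_pos hj)
  have x_le_compl {j} (hj : j ∉ code k) : x ≤ (digit f code j)ᶜ :=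
    (Finset.inf_le (Finset.mem_univ j)).trans_eq (if_neg hj)
  have x_disjoint {l} (hl : l ≠ k) : Disjoint x (f l) := by
    obtain ⟨j, hj⟩ : ∃ j, ¬(j ∈ code l ↔ j ∈ code k) := by
      by_contra! h
      exact hl (hcode (Finset.ext h))
    by_cases hjk : j ∈ code k
    · exact (disjoint_digit hf fun hjl => hj (iff_of_true hjl hjk)).symm.mono_left (x_le_digit hjk)
    · have hjl : j ∈ code l := by tauto
      exact le_compl_iff_disjoint_right.1 (x_le_compl hjk) |>.mono_right (le_digit hjl)
  refine le_antisymm (Finset.le_inf fun j _ => ?_) ?_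
  · split_ifs with hj
    · exact le_digit hj
    · exact le_compl_iff_disjoint_right.2 (disjoint_digit hf hj)
  · obtain ⟨j, hj⟩ := hk
    have hxj : x ⊓ digit f code j ≤ f k := by
      rw [digit, Finset.sup_inf_distrib_left]
      refine Finset.sup_le fun l _ => ?_
      obtain rfl | hl := eq_or_ne l k
      · exact inf_le_right
      · exact (x_disjoint hl).le_bot.trans bot_le
    exact (le_inf le_rfl (x_le_digit hj)).trans hxj

theorem exists_injective_code [Fintype κ] {m : ℕ} (hm : Fintype.card κ < 2 ^ m) :
    ∃ code : κ → Finset (Fin m), Injective code ∧ ∀ k, (code k).Nonempty := by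
  classical
  have hcard : Fintype.card κ ≤ Fintype.card {c : Finset (Fin m) // c ≠ ∅} := by
    rw [Fintype.card_subtype_compl, Fintype.card_finset, Fintype.card_fin,
      Fintype.card_subtype_eq]
    exact Nat.le_sub_one_of_lt hm
  obtain ⟨code⟩ := Embedding.nonempty_of_card_le hcard
  exact ⟨fun k => (code k).1, Subtype.val_injective.comp code.injective,
    fun k => Finset.nonempty_iff_ne_empty.2 (code k).2⟩

theorem exists_mem_closure_forall_mem_closure_range [Fintype κ] {f : κ → B}
    (hf : Pairwise (Disjoint on f)) {m : ℕ} (hm : Fintype.card κ < 2 ^ m) :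
    ∃ g : Fin m → B, (∀ j, g j ∈ BooleanSubalgebra.closure (Set.range f)) ∧
      ∀ k, f k ∈ BooleanSubalgebra.closure (Set.range g) := by
  obtain ⟨code, hcode, hne⟩ := exists_injective_code hm
  refine ⟨digit f code, fun j => ?_, fun k => ?_⟩
  · exact Finset.sup_mem _ BooleanSubalgebra.bot_mem
      (fun _ hx _ hy => BooleanSubalgebra.sup_mem hx hy) _ _
      fun k _ => BooleanSubalgebra.subset_closure ⟨k, rfl⟩
  · rw [eq_inf_digit hf hcode (hne k)]
    refine Finset.inf_mem _ BooleanSubalgebra.top_mem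
      (fun _ hx _ hy => BooleanSubalgebra.inf_mem hx hy) _ _ fun j _ => ?_
    have hj : digit f code j ∈ BooleanSubalgebra.closure (Set.range (digit f code)) :=
      BooleanSubalgebra.subset_closure ⟨j, rfl⟩
    split_ifs
    · exact hj
    · exact BooleanSubalgebra.compl_mem hj

end BooleanAlgebra

section Generation

variable {ι : Type u} {A : Type v} [BooleanAlgebra A] [Ops ι A]

theorem InSg.mem_of_subset {X : Set A} {S : Subalgebra ι A} (hX : X ⊆ S.carrier) {x : A}
    (hx : InSg ι X x) : x ∈ S.carrier := by
  induction hx with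
  | basic h => exact hX h
  | bot => exact S.bot_mem'
  | sup _ _ hx hy => exact S.supClosed' hx hy
  | compl _ hx => exact S.compl_mem' hx
  | cyl i _ hx => exact S.cyl_mem' i hx
  | diag i j => exact S.diag_mem' i j
  | subst i j _ hx => exact S.subst_mem' i j hx

theorem closure_le_Sg (X : Set A) :
    BooleanSubalgebra.closure X ≤ (Sg ι X).toBooleanSubalgebra :=
  BooleanSubalgebra.closure_le.2 fun _ => InSg.basic

theorem Subalgebra.inSg_coe {S : Subalgebra ι A} {X : Set S.Carrier} {x : S.Carrier}
    (hx : InSg ι X x) : InSg ι (Subtype.val '' X) (x : A) := by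
  induction hx with
  | basic h => exact .basic ⟨_, h, rfl⟩
  | bot => exact .bot
  | sup _ _ hx hy => exact .sup hx hy
  | compl _ hx => exact .compl hx
  | cyl i _ hx => exact .cyl i hx
  | diag i j => exact .diag i j
  | subst i j _ hx => exact .subst i j hx

theorem Subalgebra.exists_inSg_of_inSg_image {S : Subalgebra ι A} {X : Set S.Carrier} {x : A}
    (hx : InSg ι (Subtype.val '' X) x) : ∃ h : x ∈ S.carrier, InSg ι X (⟨x, h⟩ : S.Carrier) := by
  induction hx with
  | basic h => obtain ⟨y, hy, rfl⟩ := h; exact ⟨y.2, .basic hy⟩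
  | bot => exact ⟨_, .bot⟩
  | sup _ _ hx hy => exact ⟨_, .sup hx.2 hy.2⟩
  | compl _ hx => exact ⟨_, .compl hx.2⟩
  | cyl i _ hx => exact ⟨_, .cyl i hx.2⟩
  | diag i j => exact ⟨_, .diag i j⟩
  | subst i j _ hx => exact ⟨_, .subst i j hx.2⟩

theorem generates_Sg_iff {Y : Set A} {X : Set (Sg ι Y).Carrier} :
    Generates ι X ↔ Y ⊆ (Sg ι (Subtype.val '' X)).carrier :=
  ⟨fun hX y hy => Subalgebra.inSg_coe (hX ⟨y, .basic hy⟩), fun hY x =>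
    (Subalgebra.exists_inSg_of_inSg_image (InSg.mem_of_subset hY x.2)).2⟩

theorem exists_generates_Sg_range {κ : Type*} [Fintype κ] {f : κ → A}
    (hf : Pairwise (Disjoint on f)) {m : ℕ} (hm : Fintype.card κ < 2 ^ m) :
    ∃ X : Set (Sg ι (Set.range f)).Carrier, X.encard ≤ m ∧ Generates ι X := by
  obtain ⟨g, hg, hfg⟩ := exists_mem_closure_forall_mem_closure_range hf hm
  let g' (j : Fin m) : (Sg ι (Set.range f)).Carrier := ⟨g j, closure_le_Sg _ (hg j)⟩
  refine ⟨Set.range g', ?_, generates_Sg_iff.2 (Set.range_subset_iff.2 fun k => ?_)⟩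
  · simpa using Set.encard_image_le g' Set.univ
  · rw [← Set.range_comp]
    exact closure_le_Sg _ (hfg k)

end Generation

section Simple

variable {ι : Type u} {A : Type v} [BooleanAlgebra A] [Ops ι A]

theorem IsCongruence.foldr_cyl {r : Setoid A} (hr : IsCongruence ι r) (l : List ι) {x y : A}
    (h : r x y) : r (l.foldr Ops.cyl x) (l.foldr Ops.cyl y) := by
  induction l with
  | nil => exact h
  | cons i l ih => exact hr.cyl i ih

theorem IsCongruence.symmDiff_bot {r : Setoid A} (hr : IsCongruence ι r) {x y : A} (h : r x y) :
    r (symmDiff x y) ⊥ := by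
  simpa [symmDiff_eq] using
    hr.sup (hr.inf h (r.refl' yᶜ)) (hr.inf (r.refl' y) (hr.compl h))

theorem IsCongruence.eq_top_of_top_bot {r : Setoid A} (hr : IsCongruence ι r) (h : r ⊤ ⊥) :
    r = ⊤ := by
  have rel_bot (x : A) : r x ⊥ := by simpa using hr.inf (r.refl' x) h
  exact Setoid.eq_top_iff.2 fun x y => r.trans' (rel_bot x) (r.symm' (rel_bot y))

theorem isSimple_of_forall_exists_foldr_cyl_eq_top [Nontrivial A]
    (hbot : ∀ i : ι, Ops.cyl i (⊥ : A) = ⊥)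
    (htop : ∀ x : A, x ≠ ⊥ → ∃ l : List ι, l.foldr Ops.cyl x = ⊤) : IsSimple ι A := by
  refine ⟨inferInstance, fun r hr => or_iff_not_imp_left.2 fun hne => ?_⟩
  obtain ⟨x, y, hxy, hxy'⟩ : ∃ x y, r x y ∧ x ≠ y := by
    by_contra! h
    exact hne (le_bot_iff.1 fun {x y} => h x y)
  obtain ⟨l, hl⟩ := htop (symmDiff x y) (symmDiff_eq_bot.not.2 hxy')
  have hlbot : l.foldr Ops.cyl (⊥ : A) = ⊥ := List.foldrRecOn l Ops.cyl (motive := (· = ⊥)) rfl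
    fun _ hx i _ => hx ▸ hbot i
  exact hr.eq_top_of_top_bot (hl ▸ hlbot ▸ hr.foldr_cyl l (hr.symmDiff_bot hxy))

theorem Subalgebra.coe_foldr_cyl {S : Subalgebra ι A} (l : List ι) (x : S.Carrier) :
    ((l.foldr Ops.cyl x : S.Carrier) : A) = l.foldr Ops.cyl (x : A) := by
  induction l with
  | nil => rfl
  | cons i l ih => exact congrArg (Ops.cyl i) ih

end Simple

section SetAlgebra

variable {ι : Type u} {U : Type v} {W : Set (ι → U)}

open Classical in
theorem mem_subst_iff {i j : ι} {X : Set W} {s t : W} (h : t.1 = s.1 ∘ Equiv.swap i j) :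
    s ∈ Ops.subst i j X ↔ t ∈ X :=
  ⟨fun ⟨_, hr, hrs⟩ => Subtype.ext (hrs.trans h.symm) ▸ hr, fun ht => ⟨t, ht, h⟩⟩

theorem cyl_bot (i : ι) : Ops.cyl i (⊥ : Set W) = ⊥ :=
  Set.eq_empty_of_forall_notMem fun _ ⟨_, h, _⟩ => h

end SetAlgebra

section WeakSpace

variable (ι : Type u) (K : Type v)

/-- The full set algebra on the weak space of finitely supported sequences over `K`. -/
abbrev WeakSetAlgebra [Zero K] := Set (weakSpace fun _ : ι => (0 : K))

variable {ι K}

/-- Finitely supported functions as the points of the weak space. -/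
@[simps]
noncomputable def toWeak [Zero K] : (ι →₀ K) ≃ weakSpace fun _ : ι => (0 : K) where
  toFun s := ⟨s, s.hasFiniteSupport⟩
  invFun s := .ofSupportFinite s.1 s.2
  left_inv _ := Finsupp.ext fun _ => rfl
  right_inv _ := rfl

theorem weakSet_ext [Zero K] {X Y : WeakSetAlgebra ι K}
    (h : ∀ s, toWeak s ∈ X ↔ toWeak s ∈ Y) : X = Y :=
  Set.ext (toWeak.forall_congr_right.1 h)

theorem toWeak_mem_cyl [AddCommGroup K] {i : ι} {X : WeakSetAlgebra ι K} {s : ι →₀ K} :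
    toWeak s ∈ Ops.cyl i X ↔ ∃ q, toWeak (s + .single i q) ∈ X := by
  refine ⟨fun ⟨t, ht, hts⟩ => ?_, fun ⟨q, hq⟩ => ⟨_, hq, fun j hj => ?_⟩⟩
  · obtain ⟨t, rfl⟩ := toWeak.surjective t
    have hst : s + .single i (t i - s i) = t := by
      ext j
      obtain rfl | hj := eq_or_ne j i
      · simp
      · simpa [hj] using (hts j hj).symm
    exact ⟨_, hst ▸ ht⟩
  · simp [hj]

theorem toWeak_mem_foldr_cyl [AddCommGroup K] {X : WeakSetAlgebra ι K} (l : List ι)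
    {s d : ι →₀ K} (hd : ∀ i ∈ d.support, i ∈ l) (h : toWeak (s + d) ∈ X) :
    toWeak s ∈ l.foldr Ops.cyl X := by
  classical
  induction l generalizing s d with
  | nil =>
    obtain rfl : d = 0 := Finsupp.support_eq_empty.1
      (Finset.eq_empty_of_forall_notMem fun i hi => List.not_mem_nil (hd i hi))
    simpa using h
  | cons i l ih =>
    refine toWeak_mem_cyl.2 ⟨d i, ih (d := d.erase i) (fun j hj => ?_) ?_⟩
    · rw [Finsupp.support_erase, Finset.mem_erase] at hj
      exact (List.mem_cons.1 (hd j hj.2)).resolve_left hj.1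
    · rwa [add_assoc, Finsupp.single_add_erase]

variable [Field K]

open Classical in
/-- The action of a transposition of coordinates on finitely supported functions. -/
noncomputable def swapMap (i j : ι) : (ι →₀ K) ≃ₗ[K] (ι →₀ K) :=
  Finsupp.domLCongr (Equiv.swap i j)

@[simp]
theorem swapMap_swapMap (i j : ι) (s : ι →₀ K) : swapMap i j (swapMap i j s) = s :=
  Finsupp.ext fun k => by simp [swapMap]

theorem toWeak_mem_subst {i j : ι} {X : WeakSetAlgebra ι K} {s : ι →₀ K} :
    toWeak s ∈ Ops.subst i j X ↔ toWeak (swapMap i j s) ∈ X := by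
  classical
  exact mem_subst_iff (funext fun k => by simp [swapMap])

variable (ι K) in
/-- The sum of the coordinates. -/
noncomputable def total : Module.Dual K (ι →₀ K) := Finsupp.linearCombination K fun _ => 1

@[simp]
theorem total_single (i : ι) (q : K) : total ι K (.single i q) = q := by
  simp [total]

@[simp]
theorem total_swapMap (i j : ι) (s : ι →₀ K) : total ι K (swapMap i j s) = total ι K s := by
  simp [total, swapMap, Finsupp.domLCongr_apply, Finsupp.domCongr_apply,
    Finsupp.equivMapDomain_eq_mapDomain, Finsupp.linearCombination_mapDomain, Function.comp_def]

variable (ι) in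
/-- The hyperplane of the points whose coordinates sum to `c`. -/
def level (c : K) : WeakSetAlgebra ι K := {s | ∑ᶠ i, s.1 i = c}

theorem toWeak_mem_level {c : K} {s : ι →₀ K} : toWeak s ∈ level ι c ↔ total ι K s = c := by
  have hsum : ∑ᶠ i, s i = total ι K s := by
    rw [finsum_eq_sum_of_support_subset s (s := s.support) (by simp)]
    simp [total, Finsupp.linearCombination_apply, Finsupp.sum]
  simp [level, hsum]

theorem pairwise_disjoint_level : Pairwise (Disjoint on (level ι : K → WeakSetAlgebra ι K)) :=
  fun _ _ hcd => Set.disjoint_left.2 fun _ hc hd => hcd (hc.symm.trans hd)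

end WeakSpace

section Determined

variable {ι : Type u} {K : Type v} [Field K]

variable (ι K) in
/-- Affine forms on the weak space; a form stands for the affine hyperplane on which it
vanishes. -/
abbrev AffineForm := (ι →₀ K) →ᵃ[K] K

theorem AffineForm.apply_add (h : AffineForm ι K) (s d : ι →₀ K) :
    h (s + d) = h s + h.linear d := by
  simpa [add_comm] using h.map_vadd s d

/-- The coefficient of the `i`-th coordinate in an affine form. -/
noncomputable def AffineForm.coeff (h : AffineForm ι K) (i : ι) : K := h.linear (.single i 1)

theorem AffineForm.apply_add_single (h : AffineForm ι K) (s : ι →₀ K) (i : ι) (q : K) :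
    h (s + .single i q) = h s + q * h.coeff i := by
  rw [h.apply_add, coeff, ← smul_eq_mul, ← map_smul, Finsupp.smul_single_one]

/-- Membership in `X` depends only on which of the hyperplanes in `T` a point lies on. -/
def Determines (T : Set (AffineForm ι K)) (X : WeakSetAlgebra ι K) : Prop :=
  ∀ ⦃s t : ι →₀ K⦄, (∀ h ∈ T, h s = 0 ↔ h t = 0) → (toWeak s ∈ X ↔ toWeak t ∈ X)

variable {T T' : Set (AffineForm ι K)} {X Y : WeakSetAlgebra ι K}

theorem determines_bot : Determines T (⊥ : WeakSetAlgebra ι K) := fun _ _ _ => Iff.rfl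

theorem Determines.compl (hX : Determines T X) : Determines T Xᶜ :=
  fun _ _ hst => not_congr (hX hst)

theorem Determines.sup (hX : Determines T X) (hY : Determines T' Y) :
    Determines (T ∪ T') (X ⊔ Y) := fun _ _ hst =>
  or_congr (hX fun h hh => hst h (.inl hh)) (hY fun h hh => hst h (.inr hh))

theorem Determines.inf (hX : Determines T X) (hY : Determines T' Y) :
    Determines (T ∪ T') (X ⊓ Y) := fun _ _ hst =>
  and_congr (hX fun h hh => hst h (.inl hh)) (hY fun h hh => hst h (.inr hh))

theorem Determines.subst (hX : Determines T X) (i j : ι) :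
    Determines ((fun h => h.comp (swapMap i j).toLinearMap.toAffineMap) '' T)
      (Ops.subst i j X) := by
  intro s t hst
  rw [toWeak_mem_subst, toWeak_mem_subst]
  exact hX fun h hh => hst _ ⟨h, hh, rfl⟩

/-- The form `s ↦ s i - s j`. -/
noncomputable def AffineForm.diag (i j : ι) : AffineForm ι K :=
  LinearMap.toAffineMap (Finsupp.lapply i - Finsupp.lapply j)

theorem determines_diag (i j : ι) :
    Determines {AffineForm.diag i j} (Ops.diag i j : WeakSetAlgebra ι K) := by
  intro s t hst
  simpa [AffineForm.diag, Ops.diag, sub_eq_zero] using hst _ rfl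

/-- The form `s ↦ ∑ i, s i - c`. -/
noncomputable def AffineForm.level (c : K) : AffineForm ι K :=
  (total ι K).toAffineMap - AffineMap.const K _ c

theorem determines_level (c : K) : Determines {AffineForm.level c} (level ι c) := by
  intro s t hst
  simpa [AffineForm.level, sub_eq_zero, toWeak_mem_level] using hst _ rfl

namespace AffineForm

/-- The displacement in the direction `i` that takes `s` to the hyperplane `h = 0`, provided
that `h.coeff i ≠ 0`. -/
noncomputable def root (i : ι) (h : AffineForm ι K) (s : ι →₀ K) : K := -((h.coeff i)⁻¹ * h s)

theorem apply_add_single_eq_zero_iff {i : ι} {h : AffineForm ι K} (hi : h.coeff i ≠ 0)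
    {s : ι →₀ K} {q : K} : h (s + .single i q) = 0 ↔ q = h.root i s := by
  rw [apply_add_single, root, ← mul_neg, eq_inv_mul_iff_mul_eq₀ hi, eq_neg_iff_add_eq_zero,
    add_comm, mul_comm]

/-- The form obtained from `h` and `h'` by eliminating the coordinate `i`; it vanishes where
`h` and `h'` have the same root in the direction `i`. -/
noncomputable def elim (i : ι) (h h' : AffineForm ι K) : AffineForm ι K :=
  (h.coeff i)⁻¹ • h - (h'.coeff i)⁻¹ • h'

theorem elim_apply_eq_zero_iff {i : ι} {h h' : AffineForm ι K} {s : ι →₀ K} :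
    elim i h h' s = 0 ↔ h.root i s = h'.root i s := by
  simp [elim, root, sub_eq_zero]

/-- The forms, constant in the direction `i`, which decide whether a set determined by `T` is
met by the line in the direction `i` through a point. -/
noncomputable def eliminate (i : ι) (T : Set (AffineForm ι K)) : Set (AffineForm ι K) :=
  {h ∈ T | h.coeff i = 0} ∪
    Set.image2 (elim i) {h ∈ T | h.coeff i ≠ 0} {h ∈ T | h.coeff i ≠ 0}

theorem finite_eliminate (i : ι) (hT : T.Finite) : (eliminate i T).Finite :=
  (hT.sep _).union ((hT.sep _).image2 _ (hT.sep _))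

theorem coeff_eq_zero_of_mem_eliminate {i : ι} {h : AffineForm ι K} (hh : h ∈ eliminate i T) :
    h.coeff i = 0 := by
  rcases hh with hh | ⟨p, ⟨-, hp⟩, p', ⟨-, hp'⟩, rfl⟩
  · exact hh.2
  · simp only [coeff] at hp hp'
    simp [coeff, elim, hp, hp']

end AffineForm

open AffineForm

theorem Determines.cyl [Infinite K] (hX : Determines T X) (hT : T.Finite) (i : ι) :
    Determines (eliminate i T) (Ops.cyl i X) := by
  suffices H : ∀ ⦃s t : ι →₀ K⦄, (∀ h ∈ eliminate i T, h s = 0 ↔ h t = 0) →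
      toWeak s ∈ Ops.cyl i X → toWeak t ∈ Ops.cyl i X from
    fun s t hst => ⟨H hst, H fun h hh => (hst h hh).symm⟩
  intro s t hst hs
  obtain ⟨q, hq⟩ := toWeak_mem_cyl.1 hs
  obtain ⟨q', hq'⟩ : ∃ q', ∀ h ∈ T, h.coeff i ≠ 0 → (q = h.root i s ↔ q' = h.root i t) := by
    by_cases! hroot : ∃ p ∈ T, p.coeff i ≠ 0 ∧ q = p.root i s
    · obtain ⟨p, hp, hpi, rfl⟩ := hroot
      refine ⟨p.root i t, fun h hh hi => ?_⟩
      simpa only [elim_apply_eq_zero_iff] using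
        hst _ (.inr ⟨p, ⟨hp, hpi⟩, h, ⟨hh, hi⟩, rfl⟩)
    · obtain ⟨q', hq'⟩ := (hT.image fun h => h.root i t).exists_notMem
      exact ⟨q', fun h hh hi =>
        iff_of_false (hroot h hh hi) fun hqh => hq' ⟨h, hh, hqh.symm⟩⟩
  refine toWeak_mem_cyl.2 ⟨q', (hX fun h hh => ?_).1 hq⟩
  by_cases hi : h.coeff i = 0
  · simpa [apply_add_single, hi] using hst h (.inl ⟨hh, hi⟩)
  · simpa only [apply_add_single_eq_zero_iff hi] using hq' h hh hi

variable (ι K) in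
/-- The finite Boolean combinations of affine hyperplanes, encoded as the sets for which membership
depends only on the incidence of a point with finitely many hyperplanes. -/
def constructible [Infinite K] : Subalgebra ι (WeakSetAlgebra ι K) where
  carrier := {X | ∃ T, T.Finite ∧ Determines T X}
  supClosed' := fun _ ⟨_, hT, hX⟩ _ ⟨_, hT', hY⟩ => ⟨_, hT.union hT', hX.sup hY⟩
  infClosed' := fun _ ⟨_, hT, hX⟩ _ ⟨_, hT', hY⟩ => ⟨_, hT.union hT', hX.inf hY⟩
  compl_mem' := fun ⟨T, hT, hX⟩ => ⟨T, hT, hX.compl⟩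
  bot_mem' := ⟨∅, Set.finite_empty, determines_bot⟩
  cyl_mem' := fun i _ ⟨_, hT, hX⟩ => ⟨_, finite_eliminate i hT, hX.cyl hT i⟩
  diag_mem' := fun i j => ⟨_, Set.finite_singleton _, determines_diag i j⟩
  subst_mem' := fun i j _ ⟨_, hT, hX⟩ => ⟨_, hT.image _, hX.subst i j⟩

theorem level_mem_constructible [Infinite K] (c : K) : level ι c ∈ (constructible ι K).carrier :=
  ⟨_, Set.finite_singleton _, determines_level c⟩

end Determined

section Simplicity

variable {ι : Type u} {K : Type v}

theorem exists_finset_map_supported_eq_range {R M : Type*} [Ring R] [AddCommGroup M] [Module R M]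
    [IsNoetherian R M] (L : (ι →₀ R) →ₗ[R] M) :
    ∃ F : Finset ι, (Finsupp.supported R R (F : Set ι)).map L = L.range := by
  classical
  have hle : L.range ≤ ⨆ i, (Finsupp.supported R R {i}).map L := by
    rw [← Submodule.map_iSup, ← Finsupp.supported_iUnion, Set.iUnion_of_singleton,
      Finsupp.supported_univ, LinearMap.range_eq_map]
  obtain ⟨F, hF⟩ := CompleteLattice.IsCompactElement.exists_finset_of_le_iSup _
    ((Submodule.fg_iff_compact _).1 (IsNoetherian.noetherian L.range)) _ hle
  refine ⟨F, (L.map_le_range).antisymm (hF.trans (iSup₂_le fun i hi => Submodule.map_mono ?_))⟩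
  exact Finsupp.supported_mono (by simpa using hi)

variable [Field K]

theorem Determines.exists_foldr_cyl_eq_top {T : Set (AffineForm ι K)} (hT : T.Finite)
    {X : WeakSetAlgebra ι K} (hX : Determines T X) (hne : X ≠ ⊥) :
    ∃ l : List ι, l.foldr Ops.cyl X = ⊤ := by
  have := hT.to_subtype
  obtain ⟨s, hs⟩ := toWeak.surjective.exists.1 (Set.nonempty_iff_ne_empty.2 hne)
  let L : (ι →₀ K) →ₗ[K] T → K := LinearMap.pi fun h => h.1.linear
  obtain ⟨F, hF⟩ := exists_finset_map_supported_eq_range L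
  refine ⟨F.toList, weakSet_ext fun t => iff_of_true ?_ trivial⟩
  obtain ⟨d, hdF, hd⟩ : L (s - t) ∈ (Finsupp.supported K K (F : Set ι)).map L :=
    hF ▸ LinearMap.mem_range_self L _
  refine toWeak_mem_foldr_cyl _ (fun i hi => by simpa using hdF hi) ((hX fun h hh => ?_).1 hs)
  have hlin : h.linear d = h.linear (s - t) := congrFun hd ⟨h, hh⟩
  rw [h.apply_add, hlin, ← h.apply_add, add_sub_cancel]

theorem isSimple_of_le_constructible [Infinite K] {S : Subalgebra ι (WeakSetAlgebra ι K)}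
    (hS : S.carrier ⊆ (constructible ι K).carrier) : IsSimple ι S.Carrier := by
  have : Nonempty (weakSpace fun _ : ι => (0 : K)) := ⟨toWeak 0⟩
  have : Nontrivial S.Carrier :=
    ⟨⊥, ⊤, fun h => bot_ne_top (α := WeakSetAlgebra ι K) (congrArg Subtype.val h)⟩
  refine isSimple_of_forall_exists_foldr_cyl_eq_top (fun i => Subtype.ext (cyl_bot i))
    fun x hx => ?_
  obtain ⟨T, hT, hxT⟩ := hS x.2
  obtain ⟨l, hl⟩ := hxT.exists_foldr_cyl_eq_top hT fun h => hx (Subtype.ext h)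
  exact ⟨l, Subtype.ext ((Subalgebra.coe_foldr_cyl l x).trans hl)⟩

end Simplicity

section Generic

variable {ι : Type u} {K : Type v} [Field K]

/-- The hyperplane `h = 0` is not parallel to the hyperplanes `level c`. -/
def AffineForm.Skew (h : AffineForm ι K) : Prop := ∃ d, total ι K d = 0 ∧ h.linear d ≠ 0

theorem AffineForm.eq_of_total_eq {h : AffineForm ι K} (hh : ¬h.Skew) {s t : ι →₀ K}
    (hst : total ι K s = total ι K t) : h s = h t := by
  have hlin : h.linear (s - t) = 0 := by
    by_contra hne
    exact hh ⟨s - t, by rw [map_sub, hst, sub_self], hne⟩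
  rw [← add_sub_cancel t s, h.apply_add, hlin, add_zero]

theorem AffineForm.linear_eq_zero_or_skew {h : AffineForm ι K} {i : ι} (hi : h.coeff i = 0) :
    h.linear = 0 ∨ h.Skew := by
  refine or_iff_not_imp_right.2 fun hh => Finsupp.lhom_ext' fun j => LinearMap.ext_ring ?_
  by_contra hj
  refine hh ⟨.single j 1 - .single i 1, by simp, ?_⟩
  rwa [map_sub, show h.linear (.single i 1) = 0 from hi, sub_zero]

theorem AffineForm.diag_linear_eq_zero_or_skew [NeZero (2 : K)] (i j : ι) :
    (diag i j : AffineForm ι K).linear = 0 ∨ (diag i j : AffineForm ι K).Skew := by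
  obtain rfl | hij := eq_or_ne i j
  · exact .inl (by simp [diag])
  · refine .inr ⟨.single i 1 - .single j 1, by simp, ?_⟩
    simp [diag, hij, hij.symm, one_add_one_eq_two, two_ne_zero]

/-- The filter of generic points of `level c`: these are the points outside any given finite
set of hyperplanes not parallel to it. -/
def generic (c : K) : Filter (ι →₀ K) :=
  𝓟 {p | total ι K p = c} ⊓ ⨅ h : {h : AffineForm ι K // h.Skew}, 𝓟 {p | h.1 p ≠ 0}

theorem eventually_total_eq (c : K) : ∀ᶠ p : ι →₀ K in generic c, total ι K p = c :=
  mem_inf_of_left (mem_principal_self _)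

theorem AffineForm.Skew.eventually_ne_zero {h : AffineForm ι K} (hh : h.Skew) (c : K) :
    ∀ᶠ p in generic c, h p ≠ 0 :=
  mem_inf_of_right (mem_iInf_of_mem (⟨h, hh⟩ : {h : AffineForm ι K // h.Skew})
    (mem_principal_self _))

theorem exists_total_eq_forall_ne_zero [Nonempty ι] [Infinite K] (c : K) {κ : Type*} [Finite κ]
    {h : κ → AffineForm ι K} (hskew : ∀ k, (h k).Skew) :
    ∃ p, total ι K p = c ∧ ∀ k, h k p ≠ 0 := by
  obtain ⟨i⟩ := ‹Nonempty ι›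
  obtain ⟨d, hd, hdh⟩ := Module.Dual.exists_forall_mem_ne_zero_of_forall_exists
    (LinearMap.ker (total ι K)) (fun k => (h k).linear) hskew
  obtain ⟨q, hq⟩ :=
    (Set.finite_range fun k => -(h k (.single i c) / (h k).linear d)).exists_notMem
  refine ⟨.single i c + q • d, by simpa using .inr hd, fun k h0 => hq ⟨k, ?_⟩⟩
  rw [AffineForm.apply_add, map_smul, smul_eq_mul] at h0
  rw [neg_eq_iff_eq_neg, div_eq_iff (hdh k), neg_mul]
  exact eq_neg_of_add_eq_zero_left h0

instance generic_neBot [Nonempty ι] [Infinite K] (c : K) :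
    (generic c : Filter (ι →₀ K)).NeBot := by
  refine ((hasBasis_iInf_principal_finite _).principal_inf _).neBot_iff.2 fun {T} hT => ?_
  have := hT.to_subtype
  obtain ⟨p, hp, hpT⟩ := exists_total_eq_forall_ne_zero c fun h : T => h.1.2
  exact ⟨p, hp, Set.mem_iInter₂.2 fun h hh => hpT ⟨h, hh⟩⟩

end Generic

section GenericallyMem

variable {ι : Type u} {K : Type v} [Field K]

/-- Almost all points of `level c`, in the sense of `generic c`, belong to `X`. -/
def GenericallyMem (c : K) (X : WeakSetAlgebra ι K) : Prop := ∀ᶠ p in generic c, toWeak p ∈ X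

variable {T : Set (AffineForm ι K)} {X Y : WeakSetAlgebra ι K} {c : K}

theorem eventually_forall_skew_ne_zero (hT : T.Finite) (c : K) :
    ∀ᶠ p in generic c, ∀ h ∈ T, h.Skew → h p ≠ 0 :=
  (eventually_all_finite hT).2 fun _ _ =>
    eventually_imp_distrib_left.2 fun hh => hh.eventually_ne_zero c

theorem Determines.genericallyMem_of_mem (hX : Determines T X) (hT : T.Finite) {p : ι →₀ K}
    (hpX : toWeak p ∈ X) (hp : ∀ h ∈ T, h.Skew → h p ≠ 0)
    (hc : ∀ h ∈ T, ¬h.Skew → ∀ q, total ι K q = c → h p = h q) : GenericallyMem c X := by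
  filter_upwards [eventually_total_eq c, eventually_forall_skew_ne_zero hT c] with q hq hqT
  refine (hX fun h hh => ?_).1 hpX
  by_cases hs : h.Skew
  · exact iff_of_false (hp h hh hs) (hqT h hh hs)
  · rw [hc h hh hs q hq]

theorem Determines.genericallyMem_or_compl (hX : Determines T X) (hT : T.Finite) :
    GenericallyMem c X ∨ GenericallyMem c Xᶜ := by
  refine or_iff_not_imp_right.2 fun h => ?_
  obtain ⟨p, hpX, hpc, hpT⟩ := ((not_eventually.1 h).and_eventually
    ((eventually_total_eq c).and (eventually_forall_skew_ne_zero hT c))).exists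
  exact hX.genericallyMem_of_mem hT (not_not.1 hpX) hpT
    fun h _ hs q hq => h.eq_of_total_eq hs (hpc.trans hq.symm)

theorem genericallyMem_inf_iff :
    GenericallyMem c (X ⊓ Y) ↔ GenericallyMem c X ∧ GenericallyMem c Y :=
  eventually_and

theorem tendsto_swapMap_generic (i j : ι) (c : K) :
    Tendsto (swapMap i j) (generic c) (generic c) := by
  refine tendsto_inf.2 ⟨tendsto_principal.2 ?_, tendsto_iInf.2 fun ⟨h, d, hd, hhd⟩ =>
    tendsto_principal.2 ?_⟩
  · filter_upwards [eventually_total_eq c] with p hp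
    exact (total_swapMap i j p).trans hp
  · have hs : AffineForm.Skew (h.comp (swapMap i j).toLinearMap.toAffineMap) :=
      ⟨swapMap i j d, by simpa using hd, by simpa using hhd⟩
    exact hs.eventually_ne_zero c

theorem genericallyMem_subst_iff (i j : ι) :
    GenericallyMem c (Ops.subst i j X) ↔ GenericallyMem c X := by
  refine ⟨fun h => ?_, fun h => ?_⟩
  · exact ((tendsto_swapMap_generic i j c).eventually h).mono fun p hp => by
      simpa only [swapMap_swapMap] using toWeak_mem_subst.1 hp
  · exact ((tendsto_swapMap_generic i j c).eventually h).mono fun p hp => toWeak_mem_subst.2 hp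

variable [Infinite K]

theorem genericallyMem_compl_iff [Nonempty ι] (hX : X ∈ (constructible ι K).carrier) :
    GenericallyMem c Xᶜ ↔ ¬GenericallyMem c X := by
  obtain ⟨T, hT, hX⟩ := hX
  refine ⟨fun h h' => ?_, fun h => (hX.genericallyMem_or_compl hT).resolve_left h⟩
  obtain ⟨p, hp, hp'⟩ := (h.and h').exists
  exact hp hp'

theorem genericallyMem_sup_iff (hX : X ∈ (constructible ι K).carrier) :
    GenericallyMem c (X ⊔ Y) ↔ GenericallyMem c X ∨ GenericallyMem c Y := by
  obtain ⟨T, hT, hX⟩ := hX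
  refine ⟨fun h => (hX.genericallyMem_or_compl hT).imp_right fun h' => ?_,
    fun h => h.elim (·.mono fun _ => .inl) (·.mono fun _ => .inr)⟩
  exact (h.and h').mono fun p hp => hp.1.resolve_left hp.2

theorem Determines.genericallyMem_iff [Nonempty ι] (hX : Determines T X) (hT : T.Finite)
    (hT' : ∀ h ∈ T, h.linear = 0 ∨ h.Skew) (c d : K) :
    GenericallyMem c X ↔ GenericallyMem d X := by
  suffices H : ∀ {c d : K}, GenericallyMem c X → GenericallyMem d X from ⟨H, H⟩
  intro c d hc
  obtain ⟨p, hpX, hpT⟩ := (hc.and (eventually_forall_skew_ne_zero hT c)).exists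
  refine hX.genericallyMem_of_mem hT hpX hpT fun h hh hs q _ => ?_
  rw [← add_sub_cancel p q, h.apply_add, (hT' h hh).resolve_right hs, LinearMap.zero_apply,
    add_zero]

/-- The constructible sets which generically contain both or neither of the hyperplanes
`level c` and `level d`. -/
def balanced [Nonempty ι] [NeZero (2 : K)] (c d : K) : Subalgebra ι (WeakSetAlgebra ι K) where
  carrier := {X ∈ (constructible ι K).carrier | GenericallyMem c X ↔ GenericallyMem d X}
  supClosed' := fun X ⟨hX, hcd⟩ Y ⟨hY, hcd'⟩ => ⟨(constructible ι K).supClosed' hX hY, by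
    rw [genericallyMem_sup_iff hX, genericallyMem_sup_iff hX, hcd, hcd']⟩
  infClosed' := fun X ⟨hX, hcd⟩ Y ⟨hY, hcd'⟩ => ⟨(constructible ι K).infClosed' hX hY, by
    rw [genericallyMem_inf_iff, genericallyMem_inf_iff, hcd, hcd']⟩
  compl_mem' := fun {X} ⟨hX, hcd⟩ => ⟨(constructible ι K).compl_mem' hX, by
    rw [genericallyMem_compl_iff hX, genericallyMem_compl_iff hX, hcd]⟩
  bot_mem' := ⟨(constructible ι K).bot_mem',
    determines_bot.genericallyMem_iff Set.finite_empty (by simp) c d⟩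
  cyl_mem' := fun i X ⟨hX, _⟩ => ⟨(constructible ι K).cyl_mem' i hX, by
    obtain ⟨T, hT, hX⟩ := hX
    exact (hX.cyl hT i).genericallyMem_iff (AffineForm.finite_eliminate i hT) (fun h hh =>
      h.linear_eq_zero_or_skew (AffineForm.coeff_eq_zero_of_mem_eliminate hh)) c d⟩
  diag_mem' := fun i j => ⟨(constructible ι K).diag_mem' i j,
    (determines_diag i j).genericallyMem_iff (Set.finite_singleton _)
      (by simpa using AffineForm.diag_linear_eq_zero_or_skew i j) c d⟩
  subst_mem' := fun i j X ⟨hX, hcd⟩ => ⟨(constructible ι K).subst_mem' i j hX, by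
    rw [genericallyMem_subst_iff, genericallyMem_subst_iff, hcd]⟩

theorem level_notMem_balanced [Nonempty ι] [NeZero (2 : K)] {c d : K} (hcd : c ≠ d) :
    level ι c ∉ (balanced c d).carrier := by
  intro h
  have hc : GenericallyMem c (level ι c) :=
    (eventually_total_eq c).mono fun _ => toWeak_mem_level.2
  obtain ⟨p, hpc, hpd⟩ := ((h.2.1 hc).and (eventually_total_eq d)).exists
  exact hcd ((toWeak_mem_level.1 hpc).symm.trans hpd)

end GenericallyMem

section LevelSubalgebra

variable {ι : Type u} {K : Type v} [Field K]

variable (ι) in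
/-- The subalgebra generated by the hyperplanes `level c` with `c ∈ S`. -/
abbrev levelSubalgebra (S : Set K) : Subalgebra ι (WeakSetAlgebra ι K) := Sg ι (level ι '' S)

theorem levelSubalgebra_le_constructible [Infinite K] (S : Set K) :
    (levelSubalgebra ι S).carrier ⊆ (constructible ι K).carrier :=
  fun _ => InSg.mem_of_subset (by rintro _ ⟨c, -, rfl⟩; exact level_mem_constructible c)

theorem levelSubalgebra.exists_genericallyMem_ne [Nonempty ι] [Infinite K] [NeZero (2 : K)]
    {S : Set K} {X : Set (levelSubalgebra ι S).Carrier} (hX : Generates ι X) {c d : K} (hc : c ∈ S)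
    (hcd : c ≠ d) : ∃ x ∈ X, ¬(GenericallyMem c x.1 ↔ GenericallyMem d x.1) := by
  by_contra! h
  have hbal : Subtype.val '' X ⊆ (balanced c d).carrier :=
    Set.image_subset_iff.2 fun x hx => ⟨levelSubalgebra_le_constructible S x.2, h x hx⟩
  exact level_notMem_balanced hcd
    (InSg.mem_of_subset hbal (generates_Sg_iff.1 hX ⟨c, hc, rfl⟩))

theorem levelSubalgebra.lt_encard_of_generates [Nonempty ι] [Infinite K] [NeZero (2 : K)]
    {S : Finset K} {n : ℕ} (hS : 2 ^ n ≤ S.card) {X : Set (levelSubalgebra ι (S : Set K)).Carrier}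
    (hX : Generates ι X) : n < X.encard := by
  classical
  by_contra! hle
  obtain ⟨F, rfl⟩ := (Set.finite_of_encard_le_coe hle).exists_finset_coe
  obtain ⟨d, hd⟩ := Infinite.exists_notMem_finset S
  obtain ⟨c, hc, c', hc', hcc', heq⟩ : ∃ c ∈ insert d S, ∃ c' ∈ insert d S, c ≠ c' ∧
      F.filter (GenericallyMem c ·.1) = F.filter (GenericallyMem c' ·.1) := by
    refine Finset.exists_ne_map_eq_of_card_lt_of_maps_to (t := F.powerset) ?_ fun c _ =>
      Finset.mem_powerset.2 (Finset.filter_subset _ _)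
    rw [Finset.card_powerset, Finset.card_insert_of_notMem hd, Nat.lt_succ_iff]
    exact (Nat.pow_le_pow_right two_pos (by simpa using hle)).trans hS
  wlog hcS : c ∈ S generalizing c c'
  · refine this c' hc' c hc hcc'.symm heq.symm ((Finset.mem_insert.1 hc').resolve_left ?_)
    rintro rfl
    exact hcc' ((Finset.mem_insert.1 hc).resolve_right hcS)
  obtain ⟨x, hx, hne⟩ := exists_genericallyMem_ne hX hcS hcc'
  exact hne (by simpa [show x ∈ F from hx] using Finset.ext_iff.1 heq x)

theorem levelSubalgebra.exists_generates {S : Finset K} {m : ℕ} (hS : S.card < 2 ^ m) :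
    ∃ X : Set (levelSubalgebra ι (S : Set K)).Carrier, X.encard ≤ m ∧ Generates ι X := by
  rw [levelSubalgebra, Set.image_eq_range]
  exact exists_generates_Sg_range
    (pairwise_disjoint_level.comp_of_injective Subtype.val_injective) (by simpa using hS)

end LevelSubalgebra

section Representation

/-- An ultrafilter on the finite subsets of `ι` that is finer than `atTop`. -/
noncomputable def finsetUltrafilter (ι : Type u) : Ultrafilter (Finset ι) := .of atTop

/-- The ultrapower of `U` along `finsetUltrafilter ι`. -/
abbrev Ultrapower (ι : Type u) (U : Type v) : Type (max u v) :=
  Germ (finsetUltrafilter ι : Filter (Finset ι)) U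

variable {ι : Type u} {U : Type v}

theorem eventually_mem_finsetUltrafilter (i : ι) :
    ∀ᶠ Δ : Finset ι in finsetUltrafilter ι, i ∈ Δ :=
  Ultrafilter.of_le atTop
    ((eventually_ge_atTop {i}).mono fun _ h => Finset.singleton_subset_iff.1 h)

open Classical in
/-- A representative of an element of the ultrapower, chosen constant whenever possible. -/
noncomputable def Ultrapower.rep (x : Ultrapower ι U) : Finset ι → U :=
  if h : ∃ c : U, ↑c = x then fun _ => h.choose else Quotient.out x

theorem Ultrapower.coe_rep (x : Ultrapower ι U) : (x.rep : Ultrapower ι U) = x := by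
  unfold rep
  split_ifs with h
  · exact h.choose_spec
  · exact Quotient.out_eq x

theorem Ultrapower.rep_const (c : U) : rep (c : Ultrapower ι U) = fun _ => c := by
  have h : ∃ d : U, (d : Ultrapower ι U) = c := ⟨c, rfl⟩
  rw [rep, dif_pos h, Germ.const_inj.1 h.choose_spec]

open Classical in
/-- The approximation of a sequence of elements of the ultrapower by a point of the weak space
which is given by representatives on `Δ` and by `p` elsewhere. -/
noncomputable def approx (p : ι → U) (s : ι → Ultrapower ι U) (Δ : Finset ι) : weakSpace p :=
  ⟨fun i => if i ∈ Δ then (s i).rep Δ else p i,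
    Δ.finite_toSet.subset fun _ hi => by_contra fun h => hi (if_neg h)⟩

variable {p : ι → U}

theorem coe_approx (s : ι → Ultrapower ι U) (i : ι) :
    (fun Δ => (approx p s Δ).1 i : Ultrapower ι U) = s i := by
  conv_rhs => rw [← (s i).coe_rep]
  exact Germ.coe_eq.2 ((eventually_mem_finsetUltrafilter i).mono fun Δ hΔ => if_pos hΔ)

theorem approx_congr {s t : ι → Ultrapower ι U} {i : ι} (h : s i = t i) (Δ : Finset ι) :
    (approx p s Δ).1 i = (approx p t Δ).1 i := by
  simp only [approx, h]

theorem eventually_approx_const_eq (q : weakSpace p) :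
    ∀ᶠ Δ in finsetUltrafilter ι, approx p (fun i => ↑(q.1 i)) Δ = q := by
  filter_upwards [(eventually_all_finite q.2).2 fun i _ => eventually_mem_finsetUltrafilter i]
    with Δ hΔ
  refine Subtype.ext (funext fun i => ?_)
  by_cases hi : i ∈ Δ
  · simp [approx, hi, Ultrapower.rep_const]
  · simpa [approx, hi] using (not_imp_comm.1 (hΔ i) hi).symm

variable (p) in
/-- The representation of the set algebra on the weak space by subsets of the full power of the
ultrapower: `s` belongs to the image of `X` if almost all its approximations belong to `X`. -/
def ultraRep (X : Set (weakSpace p)) : Set (Set.univ : Set (ι → Ultrapower ι U)) :=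
  {s | ∀ᶠ Δ in finsetUltrafilter ι, approx p s.1 Δ ∈ X}

theorem ultraRep_cyl (i : ι) (X : Set (weakSpace p)) :
    ultraRep p (Ops.cyl i X) = Ops.cyl i (ultraRep p X) := by
  classical
  ext ⟨s, -⟩
  refine ⟨fun h => ?_, fun ⟨⟨t, _⟩, ht, hts⟩ => ?_⟩
  · obtain ⟨t, ht⟩ := Eventually.choice h
    let x : Ultrapower ι U := ↑fun Δ => (t Δ).1 i
    refine ⟨⟨update s i x, trivial⟩, ?_, fun j hj => update_of_ne hj _ _⟩
    have hi : ∀ᶠ Δ in finsetUltrafilter ι, (approx p (update s i x) Δ).1 i = (t Δ).1 i :=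
      Germ.coe_eq.1 ((coe_approx _ i).trans (update_self i x s))
    filter_upwards [ht, hi] with Δ ⟨htX, hts⟩ hi
    convert htX
    refine Subtype.ext (funext fun j => ?_)
    obtain rfl | hj := eq_or_ne j i
    · exact hi
    · exact (approx_congr (update_of_ne hj _ _) Δ).trans (hts j hj).symm
  · exact ht.mono fun Δ hΔ => ⟨_, hΔ, fun j hj => approx_congr (hts j hj) Δ⟩

theorem ultraRep_diag (i j : ι) :
    ultraRep p (Ops.diag i j : Set (weakSpace p)) = Ops.diag i j := by
  ext ⟨s, -⟩
  change (∀ᶠ Δ in finsetUltrafilter ι, (approx p s Δ).1 i = (approx p s Δ).1 j) ↔ s i = s j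
  rw [← coe_approx (p := p) s i, ← coe_approx (p := p) s j]
  exact Germ.coe_eq.symm

theorem ultraRep_subst (i j : ι) (X : Set (weakSpace p)) :
    ultraRep p (Ops.subst i j X) = Ops.subst i j (ultraRep p X) := by
  classical
  ext ⟨s, -⟩
  have happrox (k : ι) : ∀ᶠ Δ in finsetUltrafilter ι,
      (approx p (s ∘ Equiv.swap i j) Δ).1 k = (approx p s Δ).1 (Equiv.swap i j k) :=
    Germ.coe_eq.1 ((coe_approx _ k).trans (coe_approx s (Equiv.swap i j k)).symm)
  refine Iff.trans ?_ (mem_subst_iff (t := ⟨s ∘ Equiv.swap i j, Set.mem_univ _⟩) rfl).symm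
  refine eventually_congr ?_
  filter_upwards [happrox i, happrox j] with Δ hi hj
  refine mem_subst_iff (funext fun k => ?_)
  obtain rfl | hki := eq_or_ne k i
  · exact hi
  obtain rfl | hkj := eq_or_ne k j
  · exact hj
  have hk : Equiv.swap i j k = k := Equiv.swap_apply_of_ne_of_ne hki hkj
  have hs : (s ∘ Equiv.swap i j) k = s k := congrArg s hk
  exact (approx_congr hs Δ).trans (congrArg (approx p s Δ).1 hk.symm)

variable (p) in
theorem isHom_ultraRep : IsHom ι (ultraRep p) where
  bot := Set.ext fun _ => eventually_const
  top := Set.ext fun _ => eventually_const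
  sup _ _ := Set.ext fun _ => Ultrafilter.eventually_or
  inf _ _ := Set.ext fun _ => eventually_and
  compl _ := Set.ext fun _ => Ultrafilter.eventually_not
  cyl := ultraRep_cyl
  diag := ultraRep_diag
  subst := ultraRep_subst

variable (p) in
theorem ultraRep_injective : Injective (ultraRep p) := by
  refine fun X Y hXY => Set.ext fun q => ?_
  have hmem (Z : Set (weakSpace p)) :
      (⟨fun i => ↑(q.1 i), trivial⟩ : (Set.univ : Set (ι → Ultrapower ι U))) ∈ ultraRep p Z ↔
        q ∈ Z :=
    (eventually_congr ((eventually_approx_const_eq q).mono fun Δ hΔ => by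
      rw [hΔ])).trans eventually_const
  rw [← hmem, hXY, hmem]

end Representation

theorem Subalgebra.isRepresentable_of_weakSpace {ι : Type (max u v)} {U : Type v} {p : ι → U}
    (S : Subalgebra ι (Set (weakSpace p))) : IsRepresentable ι S.Carrier :=
  ⟨PUnit, fun _ => Ultrapower ι U, fun x _ => ultraRep p x.1,
    { bot := funext fun _ => (isHom_ultraRep p).bot
      top := funext fun _ => (isHom_ultraRep p).top
      sup := fun x y => funext fun _ => (isHom_ultraRep p).sup x.1 y.1
      inf := fun x y => funext fun _ => (isHom_ultraRep p).inf x.1 y.1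
      compl := fun x => funext fun _ => (isHom_ultraRep p).compl x.1
      cyl := fun i x => funext fun _ => (isHom_ultraRep p).cyl i x.1
      diag := fun i j => funext fun _ => (isHom_ultraRep p).diag i j
      subst := fun i j x => funext fun _ => (isHom_ultraRep p).subst i j x.1 },
    fun _ _ hxy => Subtype.ext (ultraRep_injective p (congrFun hxy PUnit.unit))⟩

theorem a_eq_level (ι : Type u) (k : ℕ) : a ι k = level ι (k : ℚ) :=
  Set.ext fun s => by simp [a, hyperplane, level, eq_comm]

theorem subalg_eq_levelSubalgebra (ι : Type u) (n : ℕ) :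
    subalg ι n = levelSubalgebra ι ((Finset.range (2 ^ n)).map Nat.castEmbedding : Finset ℚ) := by
  refine congrArg (Sg ι) (Set.ext fun x => ?_)
  simp [a_eq_level, eq_comm]

end QEA

open QEA in
theorem theorem2_general {ι : Type (max u v)} [Nonempty ι] {K : Type v} [Field K] [Infinite K]
    [NeZero (2 : K)] {S : Finset K} {n : ℕ} (hn : 2 ^ n ≤ S.card) (hn' : S.card < 2 ^ (n + 1)) :
    IsRepresentable ι (levelSubalgebra ι (S : Set K)).Carrier ∧
      IsSimple ι (levelSubalgebra ι (S : Set K)).Carrier ∧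
      (¬∃ X : Set (levelSubalgebra ι (S : Set K)).Carrier, X.encard ≤ n ∧ Generates ι X) ∧
      ∃ X : Set (levelSubalgebra ι (S : Set K)).Carrier, X.encard = n + 1 ∧ Generates ι X := by
  refine ⟨Subalgebra.isRepresentable_of_weakSpace _,
    isSimple_of_le_constructible (levelSubalgebra_le_constructible _),
    fun ⟨X, hX, hgen⟩ => (levelSubalgebra.lt_encard_of_generates hn hgen).not_ge hX, ?_⟩
  obtain ⟨X, hX, hgen⟩ := levelSubalgebra.exists_generates (ι := ι) hn'
  have hX' := Order.add_one_le_of_lt (levelSubalgebra.lt_encard_of_generates hn hgen)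
  exact ⟨X, le_antisymm (by exact_mod_cast hX) hX', hgen⟩

theorem theorem2 (α : Ordinal.{u}) (hα : 0 < α) :
    (∀ n : ℕ,
      QEA.IsSimple α.ToType (QEA.Alg α.ToType n) ∧
      (¬ ∃ X : Set (QEA.Alg α.ToType n),
        X.encard ≤ n ∧ QEA.Generates α.ToType X) ∧
      (∃ X : Set (QEA.Alg α.ToType n),
        X.encard = n + 1 ∧ QEA.Generates α.ToType X)) ∧
    (∃ (A : Type u) (_ : BooleanAlgebra A) (_ : QEA.Ops α.ToType A),
      QEA.IsRepresentable α.ToType A ∧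
      QEA.IsSimple α.ToType A ∧
      (∃ X : Set A, X.Finite ∧ QEA.Generates α.ToType X) ∧
      ¬ ∃ x : A, QEA.Generates α.ToType ({x} : Set A)) := by
  have : Nonempty α.ToType := Ordinal.nonempty_toType_iff.2 hα.ne'
  have H (n : ℕ) := QEA.subalg_eq_levelSubalgebra α.ToType n ▸
    theorem2_general.{u, 0} (ι := α.ToType) (n := n) (by simp) (by simp [pow_succ])
  obtain ⟨hrep, hsimple, hnot, X, hX, hgen⟩ := H 1
  exact ⟨fun n => (H n).2, _, _, _, hrep, hsimple, ⟨X, Set.finite_of_encard_eq_coe hX, hgen⟩,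
    fun ⟨x, hx⟩ => hnot ⟨{x}, by simp, hx⟩⟩
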